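/- Let $0<s<1$. For $i\in\{0,1,2\}$ (indices mod $3$) let $\rho$ be the rotation of $\mathbb R^2$ by $2\pi/3$ about the origin and put $\ell_i=\rho^i(2,0)$, $m_i=\rho^i(s,\sqrt3 s)$. Let $F_i$ be the parallelogram with vertex $0$ spanned by $\ell_i$ and $m_i$, and let $L_i$ be the lattice generated by $m_i$ and $\ell_{i+1}$; both $F_i$ and $F_{i+1}$ are fundamental domains of $L_i$, so almost every $p\in F_i$ has a unique $v\in L_i$ with $p+v\in F_{i+1}$, and this defines $g_s:F_i\to F_{i+1}$, $g_s(p)=p+v$, almost everywhere. Let $X_s$ be the parallelogram $F_0$ translated so that its centre is the origin, and let $f'_s:X_s\to X_s$ be $g_s^3$ (restricted to $F_0$), transported to $X_s$ by this translation. Let $w=2-2\lfloor 1/s\rfloor s$. The cut-and-paste operation $\mathcal{OP}:X_s\to X_s$ translates the parallelogram in $X_s$ at the lower left vertex of $X_s$ with sides $(w,0)$ and $(s,\sqrt3 s)$ by $(2-w,0)$, and the rest of $X_s$ by $(-w,0)$. The triple lattice PET is $f_s=\mathcal{OP}\circ f'_s\circ\mathcal{OP}^{-1}$. It translates each of finitely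 many open convex polygons $A_1,\dots,A_m\subset X_s$, namely the non-empty sets of the points at which the vectors used in the three steps of $g_s$ and in the cut-and-paste operations (before and after) have given values, with all the points involved in the interiors of the respective parallelograms and parts; $f_s$ is left undefined outside $A_1\cup\dots\cup A_m$. A point $p$ all of whose iterates are defined has the coding $\omega_0\omega_1\cdots$ given by $f_s^n(p)\in A_{\omega_n}$. If $f_s^n(p)=p$ for some $n\ge1$, then the periodic tile of $p$ is the set of all points whose coding is that of $p$. Let $\Delta_s$, the periodic pattern, be the union of all periodic tiles. Let $\varphi=\frac{\sqrt5-1}{2}$. Then $\Delta_\varphi$ is dense in $X_\varphi$; that is, the closure of $\Delta_\varphi$ is $X_\varphi$. -/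

import Mathlib

open Set

noncomputable section

namespace TripleLattice

/-! ### Exchange of pieces by translations: codings, periodic tiles, periodic pattern

Here `A i` is the interior of the `i`-th piece and `V i` its translation vector. -/

/-- The partial map with `x ↦ x + V i` for `x ∈ A i`, undefined outside `⋃ i, A i`. -/
def petMap {ι E : Type*} [AddCommGroup E] (A : ι → Set E) (V : ι → E) : E →. E :=
  fun x => ⟨∃ i, x ∈ A i, fun h => x + V h.choose⟩

/-- `petIter f n x` is `f^n (x)`, undefined as soon as one of the `n` steps is. -/
def petIter {E : Type*} (f : E →. E) (n : ℕ) (x : E) : Part E :=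
  (fun z : Part E => z.bind f)^[n] (Part.some x)

/-- `ω` is the coding of `x`: the point `f^n (x)` exists and lies in `A (ω n)`, for every `n`. -/
def HasCoding {ι E : Type*} [AddCommGroup E] (A : ι → Set E) (V : ι → E)
    (x : E) (ω : ℕ → ι) : Prop :=
  ∀ n, ∃ y ∈ petIter (petMap A V) n x, y ∈ A (ω n)

/-- `f^n (x) = x` for some `n ≥ 1`. -/
def IsPeriodicPoint {E : Type*} (f : E →. E) (x : E) : Prop :=
  ∃ n : ℕ, 0 < n ∧ x ∈ petIter f n x

/-- The set of all points that have the same coding as `p`. -/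
def tile {ι E : Type*} [AddCommGroup E] (A : ι → Set E) (V : ι → E) (p : E) : Set E :=
  {q | ∃ ω, HasCoding A V p ω ∧ HasCoding A V q ω}

/-- The union of the periodic tiles, that is of the tiles of the periodic points. -/
def periodicPattern {ι E : Type*} [AddCommGroup E] (A : ι → Set E) (V : ι → E) : Set E :=
  ⋃ p ∈ {p | IsPeriodicPoint (petMap A V) p}, tile A V p

/-! ### The triple lattice PET

Only the topology of the plane matters, so `ℝ × ℝ` is used for it. -/

/-- The closed parallelogram with vertex `c` spanned by `u` and `v`. -/
def closedPar (c u v : ℝ × ℝ) : Set (ℝ × ℝ) :=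
  {p | ∃ a ∈ Icc (0 : ℝ) 1, ∃ b ∈ Icc (0 : ℝ) 1, p = c + a • u + b • v}

/-- Its interior (for linearly independent `u`, `v`). -/
def openPar (c u v : ℝ × ℝ) : Set (ℝ × ℝ) :=
  {p | ∃ a ∈ Ioo (0 : ℝ) 1, ∃ b ∈ Ioo (0 : ℝ) 1, p = c + a • u + b • v}

/-- Twice the cube roots of unity. -/
def long : Fin 3 → ℝ × ℝ := ![(2, 0), (-1, √3), (-1, -√3)]

/-- `2 s` times the sixth roots of unity with arguments `60°, 180°, 300°`. -/
def short (s : ℝ) : Fin 3 → ℝ × ℝ := ![(s, √3 * s), (-2 * s, 0), (s, -(√3 * s))]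

/-- The interior of the parallelogram `F_i`. The six parallelograms with vertex `0` spanned by
consecutive vectors of the list `long 0, short 0, long 1, short 1, long 2, short 2` form the orbit
of the first one under the dihedral group of order 6; cyclically they are
`F_0, L_0, F_1, L_1, F_2, L_2`. -/
def F (s : ℝ) (i : Fin 3) : Set (ℝ × ℝ) := openPar 0 (long i) (short s i)

/-- The lattice `L_i`; both `F_i` and `F_{i+1}` are fundamental domains of it. -/
def L (s : ℝ) (i : Fin 3) : AddSubgroup (ℝ × ℝ) :=
  AddSubgroup.closure {short s i, long (i + 1)}

/-- The centre of `F_0`. -/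
def center (s : ℝ) : ℝ × ℝ := (1 / 2 : ℝ) • (long 0 + short s 0)

/-- `X_s`: the parallelogram `F_0` (with its boundary), moved so that its centre is the origin. -/
def X (s : ℝ) : Set (ℝ × ℝ) := closedPar (-center s) (long 0) (short s 0)

/-- The two open parallelograms into which the cut-and-paste operation cuts `X_s`: `true` is the one
of width `2 - 2 ⌊1/s⌋ s` at the lower left vertex, `false` is the rest, of width `2 ⌊1/s⌋ s`. -/
def cutPart (s : ℝ) : Bool → Set (ℝ × ℝ)
  | true => openPar (-center s) (2 - 2 * ⌊1 / s⌋ * s, 0) (short s 0)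
  | false => openPar (-center s + (2 - 2 * ⌊1 / s⌋ * s, 0)) (2 * ⌊1 / s⌋ * s, 0) (short s 0)

/-- The cut-and-paste operation translates each of the two parts by this vector: the first part is
moved to the right of the second one and the result is centred at the origin again. -/
def cutShift (s : ℝ) : Bool → ℝ × ℝ
  | true => (2 * ⌊1 / s⌋ * s, 0)
  | false => (2 * ⌊1 / s⌋ * s - 2, 0)

/-- A label of a piece of `f_s`: the lattice vectors used in the three steps
`F_0 → F_1 → F_2 → F_0`, and the parts of `X_s` that contain the point before and after them. -/
structure Label (s : ℝ) where
  pre : Bool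
  vec : ∀ i : Fin 3, L s i
  post : Bool

/-- The interiors of the pieces of `f_s = OP ∘ g_s³ ∘ OP⁻¹`, where `OP` is the cut-and-paste
operation and `g_s` moves a point of `F_i` into `F_{i+1}` by a vector of `L_i`. All but finitely
many of them are empty. Here `p = OP (q)`. -/
def A (s : ℝ) (l : Label s) : Set (ℝ × ℝ) :=
  {p | ∃ q ∈ cutPart s l.pre, p = q + cutShift s l.pre ∧
    q + center s ∈ F s 0 ∧
    q + center s + l.vec 0 ∈ F s 1 ∧
    q + center s + l.vec 0 + l.vec 1 ∈ F s 2 ∧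
    q + center s + l.vec 0 + l.vec 1 + l.vec 2 ∈ F s 0 ∧
    q + l.vec 0 + l.vec 1 + l.vec 2 ∈ cutPart s l.post}

/-- The translation vector of `f_s` on the piece with label `l`. -/
def V (s : ℝ) (l : Label s) : ℝ × ℝ :=
  -cutShift s l.pre + l.vec 0 + l.vec 1 + l.vec 2 + cutShift s l.post

/-- A nonzero vector of `L_i` cannot join two interior points of `F_{i+1}`. -/
theorem eq_of_mem_F {s : ℝ} (hs : 0 < s) (i : Fin 3) {z : ℝ × ℝ} {v w : L s i}
    (hv : z + v ∈ F s (i + 1)) (hw : z + w ∈ F s (i + 1)) : v = w := by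
  have h3 : (0 : ℝ) < √3 := by positivity
  obtain ⟨v, hv'⟩ := v
  obtain ⟨w, hw'⟩ := w
  obtain ⟨m, n, hmn⟩ := AddSubgroup.mem_closure_pair.1 (sub_mem hv' hw')
  obtain ⟨a, ⟨ha0, ha1⟩, b, ⟨hb0, hb1⟩, hab⟩ := hv
  obtain ⟨c, ⟨hc0, hc1⟩, d, ⟨hd0, hd1⟩, hcd⟩ := hw
  have key : (m : ℝ) • short s i + (n : ℝ) • long (i + 1)
      = (a - c) • long (i + 1) + (b - d) • short s (i + 1) := by
    rw [Int.cast_smul_eq_zsmul, Int.cast_smul_eq_zsmul, hmn]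
    simp only [] at hab hcd
    have : v - w = (z + v) - (z + w) := by abel
    rw [this, hab, hcd]
    module
  have hc : short s i = s • long (i + 1) - short s (i + 1) := by
    fin_cases i <;> ext <;> simp [short, long] <;> ring
  have hli : ∀ x y : ℝ, x • long (i + 1) + y • short s (i + 1) = 0 → x = 0 ∧ y = 0 := by
    intro x y hxy
    have h1 := congrArg Prod.fst hxy
    have h2 := congrArg Prod.snd hxy
    fin_cases i <;> simp [short, long] at h1 h2
    · subst h2
      simp_all [hs.ne']
    · have h2' : √3 * (-x - s * y) = 0 := by linarith
      have : -x - s * y = 0 := by simpa [h3.ne'] using h2'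
      have hy : s * y = 0 := by linarith
      have hy' : y = 0 := by simpa [hs.ne'] using hy
      subst hy'
      exact ⟨by linarith, rfl⟩
    · have hy' : y = 0 := by simpa [hs.ne'] using h2
      subst hy'
      exact ⟨by linarith, rfl⟩
  have h0 := hli (m * s + n - (a - c)) (-m - (b - d)) (by
    rw [hc] at key
    have := sub_eq_zero.2 key
    rw [← this]; module)
  have hm : m = 0 := by
    have h1 : (m : ℝ) < 1 := by linarith [h0.2]
    have h2 : (-1 : ℝ) < m := by linarith [h0.2]
    have h1' : m < 1 := by exact_mod_cast h1
    have h2' : -1 < m := by exact_mod_cast h2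
    omega
  subst hm
  have hn : n = 0 := by
    have h00 := h0.1
    push_cast at h00
    have h1 : (n : ℝ) < 1 := by linarith
    have h2 : (-1 : ℝ) < n := by linarith
    have h1' : n < 1 := by exact_mod_cast h1
    have h2' : -1 < n := by exact_mod_cast h2
    omega
  subst hn
  have : v - w = 0 := by rw [← hmn]; simp
  exact Subtype.ext (sub_eq_zero.1 this)

theorem cut_unique {s : ℝ} (h0 : 0 < s) (h1 : s < 1) {q q' : ℝ × ℝ} {c c' : Bool}
    (hq : q ∈ cutPart s c) (hq' : q' ∈ cutPart s c')
    (h : q + cutShift s c = q' + cutShift s c') : c = c' ∧ q = q' := by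
  have hfl : (⌊1 / s⌋ : ℝ) * s ≤ 1 := by
    have := Int.floor_le (1 / s); rwa [le_div_iff₀ h0] at this
  have hfp : (0 : ℝ) < (⌊1 / s⌋ : ℝ) * s := by
    refine mul_pos ?_ h0
    have : (1 : ℤ) ≤ ⌊1 / s⌋ := Int.le_floor.2 (by rw [le_div_iff₀ h0]; simpa using h1.le)
    exact_mod_cast lt_of_lt_of_le one_pos this
  have h3 : (0 : ℝ) < √3 := by positivity
  set t := (⌊1 / s⌋ : ℝ) with ht
  have aux : ∀ {p p' : ℝ × ℝ}, p ∈ cutPart s true → p' ∈ cutPart s false →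
      p + cutShift s true ≠ p' + cutShift s false := by
    rintro p p' ⟨a, ha, b, hb, rfl⟩ ⟨a', ha', b', hb', rfl⟩ he
    have e1 := congrArg Prod.fst he
    have e2 := congrArg Prod.snd he
    simp [-one_div, cutShift, short, ← ht] at e1 e2
    have hbb : b = b' := by
      rcases e2 with h | h
      · exact h
      · exact absurd h h0.ne'
    subst hbb
    have hA : 0 ≤ a * (2 - 2 * t * s) := mul_nonneg ha.1.le (by linarith)
    have hB : a' * (2 * t * s) < 2 * t * s := by nlinarith [ha'.2]
    linarith
  cases c <;> cases c'
  · exact ⟨rfl, add_right_cancel h⟩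
  · exact absurd h.symm (aux hq' hq)
  · exact absurd h (aux hq hq')
  · exact ⟨rfl, add_right_cancel h⟩

theorem cutPart_disjoint {s : ℝ} (h0 : 0 < s) (h1 : s < 1) {q : ℝ × ℝ} {c c' : Bool}
    (hq : q ∈ cutPart s c) (hq' : q ∈ cutPart s c') : c = c' := by
  have hfl : (⌊1 / s⌋ : ℝ) * s ≤ 1 := by
    have := Int.floor_le (1 / s); rwa [le_div_iff₀ h0] at this
  have hfp : (0 : ℝ) < (⌊1 / s⌋ : ℝ) * s := by
    refine mul_pos ?_ h0
    have : (1 : ℤ) ≤ ⌊1 / s⌋ := Int.le_floor.2 (by rw [le_div_iff₀ h0]; simpa using h1.le)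
    exact_mod_cast lt_of_lt_of_le one_pos this
  have h3 : (0 : ℝ) < √3 := by positivity
  set t := (⌊1 / s⌋ : ℝ) with ht
  have aux : ∀ {p : ℝ × ℝ}, p ∈ cutPart s true → p ∉ cutPart s false := by
    rintro p ⟨a, ha, b, hb, rfl⟩ ⟨a', ha', b', hb', he⟩
    have e1 := congrArg Prod.fst he
    have e2 := congrArg Prod.snd he
    simp [-one_div, short, ← ht] at e1 e2
    have hbb : b = b' := by
      rcases e2 with h | h
      · exact h
      · exact absurd h h0.ne'
    subst hbb
    have hA : a * (2 - 2 * t * s) ≤ (2 - 2 * t * s) := by nlinarith [ha.2]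
    have hB : 0 < a' * (2 * t * s) := by exact mul_pos ha'.1 (by linarith)
    linarith
  cases c <;> cases c'
  · rfl
  · exact absurd hq (aux hq')
  · exact absurd hq' (aux hq)
  · rfl

/-- The pieces are pairwise disjoint, so that `petMap (A s) (V s)` does not depend on any choice. -/
theorem A_disjoint {s : ℝ} (h0 : 0 < s) (h1 : s < 1) {l l' : Label s} {p : ℝ × ℝ}
    (h : p ∈ A s l) (h' : p ∈ A s l') : l = l' := by
  obtain ⟨q, hq, rfl, -, f1, f2, f3, hp⟩ := h
  obtain ⟨q', hq', hqq, -, f1', f2', f3', hp'⟩ := h'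
  obtain ⟨e, rfl⟩ := cut_unique h0 h1 hq hq' hqq
  obtain ⟨c, v, d⟩ := l
  obtain ⟨c', v', d'⟩ := l'
  simp only [] at *
  subst e
  have e0 : v 0 = v' 0 := eq_of_mem_F h0 0 f1 f1'
  rw [← e0] at f2' f3' hp'
  have e1 : v 1 = v' 1 := eq_of_mem_F h0 1 f2 f2'
  rw [← e1] at f3' hp'
  have e2 : v 2 = v' 2 := eq_of_mem_F h0 2 f3 f3'
  rw [← e2] at hp'
  have e3 := cutPart_disjoint h0 h1 hp hp'
  subst e3
  have : v = v' := by
    funext i; fin_cases i <;> assumption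
  subst this
  rfl

/-- The periodic pattern of the triple lattice PET `f_s`. -/
def Delta (s : ℝ) : Set (ℝ × ℝ) := periodicPattern (A s) (V s)

end TripleLattice

end

namespace TripleLattice

/-! The reason is that `f_φ` is self-similar. In coordinates along the sides of `X_φ`, twelve open
hexagons with sides in three directions and bounds in `ℤ[φ]` are moved by translations that `f_φ`
realizes. The contraction `renorm`, of ratio `φ`, maps `X_φ` onto its left part, since `φ² = 1 - φ`.
The image of each hexagon follows a finite path of hexagons, and the total displacement along it is
the linear part of `renorm` applied to the original displacement (`follows_path`, `total_path`). So
`renorm` carries orbits to orbits, and periodic points to periodic points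
(`IsPeriodicIn.renorm_add`).

Up to finitely many lines, every hexagon on which the map is not the identity is covered by
translates of renormalized hexagons met along these paths (`isCovered_piece`). A generic point can
thus be renormalized backwards until it lies in a fixed hexagon, or as often as desired. Every
hexagon contains a periodic point and has diameter at most 1, so `n` backward steps give a periodic
point within `φ ^ n` (`exists_isPeriodicIn_dist_le`). The hexagons cover `X_φ` up to lines, and
generic points are dense.

All finite checks are comparisons in `ℤ[φ]`, for which `0.618 < φ < 0.619` suffices. Only inclusions
and coverings are needed: neither that the hexagons are entire pieces nor that the returns are first
returns. -/

/-! ### The ring `ℤ[φ]`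

The pair `(a, b)` stands for `a + b φ`, where `φ = (√5 - 1) / 2`. -/

/-- The reciprocal of the golden ratio. -/
noncomputable def phi : ℝ := (√5 - 1) / 2

theorem phi_sq : phi * phi = 1 - phi := by
  have h : √5 * √5 = 5 := Real.mul_self_sqrt (by norm_num)
  unfold phi
  linarith [h]

theorem phi_gt : (0.618 : ℝ) < phi := by
  have h : (2.236 : ℝ) < √5 := Real.lt_sqrt_of_sq_lt (by norm_num)
  unfold phi
  linarith

theorem phi_lt : phi < (0.619 : ℝ) := by
  have h : √5 < (2.238 : ℝ) := (Real.sqrt_lt' (by norm_num)).2 (by norm_num)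
  unfold phi
  linarith

theorem phi_pos : 0 < phi := by linarith [phi_gt]

/-- The real number `a + b φ`. -/
noncomputable def val (c : ℤ × ℤ) : ℝ := c.1 + c.2 * phi

theorem val_zero : val 0 = 0 := by simp [val]

theorem val_add (c d : ℤ × ℤ) : val (c + d) = val c + val d := by
  simp [val]; ring

theorem val_neg (c : ℤ × ℤ) : val (-c) = -val c := by
  simp [val]; ring

/-- Multiplication by `φ`. -/
def mulPhi (c : ℤ × ℤ) : ℤ × ℤ := (c.2, c.1 - c.2)

theorem val_mulPhi (c : ℤ × ℤ) : val (mulPhi c) = phi * val c := by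
  simp only [val, mulPhi]; push_cast; linear_combination (-(c.2 : ℝ)) * phi_sq

/-- A sufficient condition for `0 ≤ a + b φ`. -/
def isNonneg (c : ℤ × ℤ) : Bool :=
  decide ((0 ≤ c.2 ∧ 0 ≤ 1000 * c.1 + 618 * c.2) ∨ (c.2 ≤ 0 ∧ 0 ≤ 1000 * c.1 + 619 * c.2))

theorem val_nonneg {c : ℤ × ℤ} (h : isNonneg c = true) : 0 ≤ val c := by
  have h1 := phi_gt
  have h2 := phi_lt
  simp only [isNonneg, decide_eq_true_eq] at h
  unfold val
  rcases h with ⟨hb, h⟩ | ⟨hb, h⟩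
  · have hb' : (0 : ℝ) ≤ c.2 := by exact_mod_cast hb
    have h' : (0 : ℝ) ≤ 1000 * c.1 + 618 * c.2 := by exact_mod_cast h
    nlinarith
  · have hb' : (c.2 : ℝ) ≤ 0 := by exact_mod_cast hb
    have h' : (0 : ℝ) ≤ 1000 * c.1 + 619 * c.2 := by exact_mod_cast h
    nlinarith

/-- The smaller one of two elements of `ℤ[φ]` (one of them in any case). -/
def smaller (c d : ℤ × ℤ) : ℤ × ℤ := if isNonneg (d - c) then c else d

theorem lt_smaller {x : ℝ} {c d : ℤ × ℤ} (hc : x < val c) (hd : x < val d) :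
    x < val (smaller c d) := by
  unfold smaller; split_ifs <;> assumption

/-! ### Hexagons with sides in three directions -/

/-- The six linear forms that bound the hexagons. -/
def form (p : ℝ × ℝ) : Fin 6 → ℝ :=
  ![p.1, -p.1, p.2, -p.2, p.1 + p.2, -(p.1 + p.2)]

/-- The same forms on vectors with entries in `ℤ[φ]`. -/
def intForm (w : (ℤ × ℤ) × (ℤ × ℤ)) : Fin 6 → ℤ × ℤ :=
  ![w.1, -w.1, w.2, -w.2, w.1 + w.2, -(w.1 + w.2)]

/-- The point with the given coordinates in `ℤ[φ]`. -/
noncomputable def vec (w : (ℤ × ℤ) × (ℤ × ℤ)) : ℝ × ℝ := (val w.1, val w.2)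

theorem vec_zero : vec 0 = 0 := by simp [vec, val_zero]

theorem vec_add (v w : (ℤ × ℤ) × (ℤ × ℤ)) : vec (v + w) = vec v + vec w := by
  simp [vec, val_add]

theorem vec_neg (v : (ℤ × ℤ) × (ℤ × ℤ)) : vec (-v) = -vec v := by
  simp [vec, val_neg]

theorem vec_zsmul (m : ℤ) (v : (ℤ × ℤ) × (ℤ × ℤ)) : vec (m • v) = m • vec v := by
  ext <;> simp [vec, val] <;> ring

theorem form_add (p q : ℝ × ℝ) (k : Fin 6) : form (p + q) k = form p k + form q k := by
  fin_cases k <;> simp [form] <;> ring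

theorem form_vec (w : (ℤ × ℤ) × (ℤ × ℤ)) (k : Fin 6) : form (vec w) k = val (intForm w k) := by
  fin_cases k <;> simp [form, intForm, vec, val_add, val_neg]

/-- The number of the negative of a form. -/
def opp : Fin 6 → Fin 6 := ![1, 0, 3, 2, 5, 4]

theorem form_opp (p : ℝ × ℝ) (k : Fin 6) : form p (opp k) = -form p k := by
  fin_cases k <;> simp [form, opp]

/-- The open hexagon with the given upper bounds of the six forms. -/
def hexagon (h : Fin 6 → ℤ × ℤ) : Set (ℝ × ℝ) := {p | ∀ k, form p k < val (h k)}

/-- A sufficient condition for the inclusion of `hexagon h` in `hexagon h'`. -/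
def isSub (h h' : Fin 6 → ℤ × ℤ) : Bool := decide (∀ k, isNonneg (h' k - h k) = true)

theorem hexagon_subset {h h' : Fin 6 → ℤ × ℤ} (H : isSub h h' = true) :
    hexagon h ⊆ hexagon h' := by
  intro p hp k
  simp only [isSub, decide_eq_true_eq] at H
  have h1 := val_nonneg (H k)
  rw [sub_eq_add_neg, val_add, val_neg] at h1
  linarith [hp k]

/-- The hexagon `h`, translated by `w`. -/
def shift (h : Fin 6 → ℤ × ℤ) (w : (ℤ × ℤ) × (ℤ × ℤ)) : Fin 6 → ℤ × ℤ :=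
  fun k => h k + intForm w k

theorem add_mem_shift {h : Fin 6 → ℤ × ℤ} {p : ℝ × ℝ} (w : (ℤ × ℤ) × (ℤ × ℤ)) :
    p + vec w ∈ hexagon (shift h w) ↔ p ∈ hexagon h := by
  simp [hexagon, shift, form_add, form_vec, val_add]

/-- A sufficient condition for a hexagon to be empty. -/
def isEmpty (h : Fin 6 → ℤ × ℤ) : Bool :=
  isNonneg (-(h 0 + h 1)) || isNonneg (-(h 2 + h 3)) || isNonneg (-(h 4 + h 5)) ||
    isNonneg (-(h 1 + h 3 + h 4)) || isNonneg (-(h 0 + h 2 + h 5))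

/-- Opposite forms sum to zero, and so do the two triples of forms with alternating directions; the
corresponding sum of bounds must then be positive at any point of the hexagon. -/
theorem notMem_of_isEmpty {h : Fin 6 → ℤ × ℤ} (H : isEmpty h = true) (p : ℝ × ℝ) :
    p ∉ hexagon h := by
  intro hp
  have h0 : p.1 < val (h 0) := hp 0
  have h1 : -p.1 < val (h 1) := hp 1
  have h2 : p.2 < val (h 2) := hp 2
  have h3 : -p.2 < val (h 3) := hp 3
  have h4 : p.1 + p.2 < val (h 4) := hp 4
  have h5 : -(p.1 + p.2) < val (h 5) := hp 5
  simp only [isEmpty, Bool.or_eq_true] at H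
  rcases H with (((H | H) | H) | H) | H <;>
  · have := val_nonneg H
    simp only [val_neg, val_add] at this
    linarith

/-! ### Covering a hexagon by others, up to lines -/

/-- The points of `P` that satisfy the bounds of `t` before the `k`-th one, but not that one. -/
def remainder (P t : Fin 6 → ℤ × ℤ) (k : Fin 6) : Fin 6 → ℤ × ℤ := fun j =>
  if j = opp k then smaller (P j) (-t k) else if j < k then smaller (P j) (t j) else P j

/-- `k n`, so written that the kernel evaluates `n` first. -/
def forceNat (n : ℕ) (k : ℕ → Bool) : Bool :=
  match n with
  | .zero => k .zero
  | .succ m => k (.succ m)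

theorem forceNat_eq (n : ℕ) (k : ℕ → Bool) : forceNat n k = k n := by
  cases n <;> rfl

/-- `k c`, so written that the kernel evaluates the entries of `c` first. -/
def forcePair (c : ℤ × ℤ) (k : ℤ × ℤ → Bool) : Bool :=
  match c with
  | (.ofNat a, .ofNat b) => forceNat a fun a => forceNat b fun b => k (.ofNat a, .ofNat b)
  | (.ofNat a, .negSucc b) => forceNat a fun a => forceNat b fun b => k (.ofNat a, .negSucc b)
  | (.negSucc a, .ofNat b) => forceNat a fun a => forceNat b fun b => k (.negSucc a, .ofNat b)
  | (.negSucc a, .negSucc b) => forceNat a fun a => forceNat b fun b => k (.negSucc a, .negSucc b)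

theorem forcePair_eq (c : ℤ × ℤ) (k : ℤ × ℤ → Bool) : forcePair c k = k c := by
  obtain ⟨a | a, b | b⟩ := c <;> simp [forcePair, forceNat_eq]

/-- `k h`, so written that the kernel evaluates the bounds of `h` first. -/
def forceHex (h : Fin 6 → ℤ × ℤ) (k : (Fin 6 → ℤ × ℤ) → Bool) : Bool :=
  forcePair (h 0) fun a => forcePair (h 1) fun b => forcePair (h 2) fun c =>
    forcePair (h 3) fun d => forcePair (h 4) fun e => forcePair (h 5) fun f =>
      k ![a, b, c, d, e, f]

theorem forceHex_eq (h : Fin 6 → ℤ × ℤ) (k : (Fin 6 → ℤ × ℤ) → Bool) : forceHex h k = k h := by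
  simp only [forceHex, forcePair_eq]
  congr 1
  ext j <;> fin_cases j <;> rfl

/-- A sufficient condition for a hexagon to be covered by others, up to their sides. -/
def isCovered : List (Fin 6 → ℤ × ℤ) → (Fin 6 → ℤ × ℤ) → Bool
  | [], P => isEmpty P
  | t :: ts, P => isEmpty P || decide (∀ k, forceHex (remainder P t k) (isCovered ts) = true)

/-- The points that lie on no line given by one of the six forms and a number in `ℤ[φ]`. -/
def generic : Set (ℝ × ℝ) := {p | ∀ k c, form p k ≠ val c}

theorem exists_mem_of_isCovered {ts : List (Fin 6 → ℤ × ℤ)} {P : Fin 6 → ℤ × ℤ}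
    (H : isCovered ts P = true) {p : ℝ × ℝ} (hp : p ∈ hexagon P) (hg : p ∈ generic) :
    ∃ t ∈ ts, p ∈ hexagon t := by
  induction ts generalizing P with
  | nil => exact absurd hp (notMem_of_isEmpty H p)
  | cons t ts ih =>
    simp only [isCovered, forceHex_eq, Bool.or_eq_true, decide_eq_true_eq] at H
    rcases H with H | H
    · exact absurd hp (notMem_of_isEmpty H p)
    by_cases ht : p ∈ hexagon t
    · exact ⟨t, by simp, ht⟩
    -- The first violated bound of `t` selects the remainder containing `p`. Genericity makes the
    -- violation strict, as open remainders require.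
    have hne : {k | ¬ form p k < val (t k)}.Nonempty := by
      simpa [hexagon, Set.Nonempty] using ht
    obtain ⟨k, hk, hmin⟩ := WellFounded.has_min (wellFounded_lt (α := Fin 6)) _ hne
    have hlt : val (t k) < form p k := lt_of_le_of_ne (not_lt.1 hk) (hg k _).symm
    have : p ∈ hexagon (remainder P t k) := by
      intro j
      unfold remainder
      split_ifs with h1 h2
      · refine lt_smaller (hp j) ?_
        rw [h1, form_opp, val_neg]
        linarith
      · refine lt_smaller (hp j) ?_
        by_contra h
        exact hmin j h h2
      · exact hp j
    obtain ⟨t', ht', h⟩ := ih (H k) this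
    exact ⟨t', List.mem_cons_of_mem _ ht', h⟩

/-- Baire's theorem: countably many lines are removed, each with dense open complement. -/
theorem dense_generic : Dense generic := by
  have key : ∀ (k : Fin 6) (c : ℤ × ℤ), IsOpen {p | form p k ≠ val c} ∧
      Dense {p | form p k ≠ val c} := by
    intro k c
    have hcont : Continuous fun p => form p k := by
      fin_cases k <;> simp [form] <;> fun_prop
    have hopen : IsOpen {p | form p k ≠ val c} := isOpen_ne_fun hcont continuous_const
    refine ⟨hopen, ?_⟩
    -- A direction transverse to the line: any nonzero displacement along it leaves the line.
    obtain ⟨e, he⟩ : ∃ e : ℝ × ℝ, ∀ t : ℝ, form (t • e) k = t := by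
      fin_cases k
      · exact ⟨(1, 0), by simp [form]⟩
      · exact ⟨(-1, 0), by simp [form]⟩
      · exact ⟨(0, 1), by simp [form]⟩
      · exact ⟨(0, -1), by simp [form]⟩
      · exact ⟨(1, 0), by simp [form]⟩
      · exact ⟨(-1, 0), by simp [form]⟩
    intro p
    have hlim : Filter.Tendsto (fun t : ℝ => p + t • e) (nhdsWithin 0 {0}ᶜ) (nhds p) := by
      have : Continuous fun t : ℝ => p + t • e := by fun_prop
      simpa using (this.tendsto 0).mono_left nhdsWithin_le_nhds
    by_cases hp : form p k = val c
    · refine mem_closure_of_tendsto hlim ?_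
      filter_upwards [self_mem_nhdsWithin] with t ht
      simpa [form_add, he, hp] using ht
    · exact subset_closure hp
  have : generic = ⋂ i : Fin 6 × (ℤ × ℤ), {p | form p i.1 ≠ val i.2} := by
    ext p; simp [generic]
  rw [this]
  exact dense_iInter_of_isOpen (fun i => (key i.1 i.2).1) fun i => (key i.1 i.2).2

/-! ### The pieces in oblique coordinates

`piece i` is the `i`-th piece of `f_φ`, `cuts i` and `steps i` describe its label. The coordinates
refer to the basis `(2, 0), (1, √3)` and the lower left vertex of `X_φ`. -/

def piece : Fin 12 → Fin 6 → ℤ × ℤ := ![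
  ![(1, 0), (0, -1), (0, 1), (1, -2), (1, 1), (0, -2)],
  ![(1, 0), (0, -1), (1, -1), (0, 0), (1, 0), (0, -1)],
  ![(1, 0), (0, -1), (1, -1), (0, 0), (0, 2), (-1, 0)],
  ![(-1, 3), (0, -1), (0, 1), (-1, 1), (0, 2), (-1, 0)],
  ![(1, -1), (1, -2), (0, 1), (2, -4), (1, 0), (1, -3)],
  ![(0, 1), (-1, 1), (0, 1), (1, -2), (0, 2), (1, -3)],
  ![(0, 1), (1, -2), (0, 1), (1, -2), (-1, 3), (2, -4)],
  ![(-1, 2), (0, 0), (0, 1), (1, -2), (-1, 3), (1, -2)],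
  ![(1, -1), (0, 0), (-1, 2), (0, 0), (0, 1), (1, -2)],
  ![(0, 1), (-1, 1), (-1, 2), (0, 0), (0, 1), (-1, 1)],
  ![(0, 1), (-1, 1), (-1, 2), (0, 0), (-1, 3), (0, -1)],
  ![(-1, 2), (0, 0), (-1, 2), (0, 0), (-1, 2), (0, 0)]]

/-- The parts of `X_φ` before and after the three steps. -/
def cuts : Fin 12 → Bool × Bool := ![
  (true, true), (true, false), (true, false), (true, true), (false, false), (false, false),
  (false, true), (false, false), (false, true), (false, false), (false, false), (false, false)]

/-- The coefficients of the lattice vectors of the three steps. -/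
def steps : Fin 12 → Fin 3 → ℤ × ℤ := ![
  ![(-2, 1), (-2, 1), (-2, 1)], ![(-1, 1), (-2, 1), (-1, 1)], ![(-1, 1), (-2, 2), (-3, 2)],
  ![(-1, 1), (-2, 2), (-2, 1)], ![(-3, 2), (-3, 2), (-3, 2)], ![(-3, 2), (-2, 1), (-1, 1)],
  ![(-2, 1), (-1, 1), (-2, 1)], ![(-2, 1), (-1, 1), (-2, 2)], ![(-2, 2), (-3, 2), (-2, 1)],
  ![(-2, 2), (-2, 1), (-1, 1)], ![(-2, 2), (-2, 2), (-2, 2)], ![(-1, 1), (-1, 1), (-1, 1)]]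

/-- The coordinates of `short φ`. -/
def intShort : Fin 3 → (ℤ × ℤ) × (ℤ × ℤ) :=
  ![((0, 0), (0, 1)), ((0, -1), (0, 0)), ((0, 1), (0, -1))]

/-- The coordinates of `long`. -/
def intLong : Fin 3 → (ℤ × ℤ) × (ℤ × ℤ) :=
  ![((1, 0), (0, 0)), ((-1, 0), (1, 0)), ((0, 0), (-1, 0))]

/-- The coordinates of `cutShift φ`. -/
def intCutShift : Bool → (ℤ × ℤ) × (ℤ × ℤ)
  | true => ((0, 1), (0, 0))
  | false => ((-1, 1), (0, 0))

/-- The lattice vector of the `k`-th step on the `i`-th piece. -/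
def intStep (i : Fin 12) (k : Fin 3) : (ℤ × ℤ) × (ℤ × ℤ) :=
  (steps i k).1 • intShort k + (steps i k).2 • intLong (k + 1)

/-- The translation vector of the `i`-th piece. -/
def move (i : Fin 12) : (ℤ × ℤ) × (ℤ × ℤ) :=
  -intCutShift (cuts i).1 + intStep i 0 + intStep i 1 + intStep i 2 + intCutShift (cuts i).2

/-- The parallelograms `F_k`. -/
def hexF : Fin 3 → Fin 6 → ℤ × ℤ := ![
  ![(1, 0), (0, 0), (0, 1), (0, 0), (1, 1), (0, 0)],
  ![(0, 0), (1, 1), (1, 0), (0, 0), (0, 0), (0, 1)],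
  ![(0, 1), (0, 0), (0, 0), (1, 1), (0, 0), (1, 0)]]

/-- The parts of `X_φ`. -/
def hexCut : Bool → Fin 6 → ℤ × ℤ
  | true => ![(1, -1), (0, 0), (0, 1), (0, 0), (1, 0), (0, 0)]
  | false => ![(1, 0), (-1, 1), (0, 1), (0, 0), (1, 1), (-1, 1)]

/-! ### Renormalization -/

/-- One step of `f_φ`. -/
def Step (p q : ℝ × ℝ) : Prop := ∃ i, p ∈ hexagon (piece i) ∧ q = p + vec (move i)

/-- The similarity that conjugates `f_φ` to its first return map to the left part of `X_φ`. -/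
noncomputable def renorm (p : ℝ × ℝ) : ℝ × ℝ :=
  (val (1, -1) - phi * p.2, val (0, 1) - phi * p.1)

/-- `renorm` takes the forms to multiples of these, up to constants. -/
def renormForm : Fin 6 → Fin 6 := ![3, 2, 1, 0, 5, 4]

theorem form_renorm (p : ℝ × ℝ) (k : Fin 6) :
    form (renorm p) k = val (intForm ((1, -1), (0, 1)) k) + phi * form p (renormForm k) := by
  fin_cases k <;> simp [form, renorm, intForm, renormForm, val] <;> ring

/-- The image of a hexagon under `renorm`. -/
def renormHex (h : Fin 6 → ℤ × ℤ) : Fin 6 → ℤ × ℤ :=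
  fun k => intForm ((1, -1), (0, 1)) k + mulPhi (h (renormForm k))

theorem renorm_mem {h : Fin 6 → ℤ × ℤ} {p : ℝ × ℝ} :
    renorm p ∈ hexagon (renormHex h) ↔ p ∈ hexagon h := by
  have hinv : ∀ k, renormForm (renormForm k) = k := by decide
  have key : ∀ k, form (renorm p) k < val (renormHex h k) ↔
      form p (renormForm k) < val (h (renormForm k)) := by
    intro k
    rw [form_renorm, renormHex, val_add, val_mulPhi, add_lt_add_iff_left,
      mul_lt_mul_iff_right₀ phi_pos]
  constructor
  · intro H k
    have := (key (renormForm k)).1 (H _)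
    rwa [hinv] at this
  · exact fun H k => (key k).2 (H _)

/-- The linear part of `renorm`. -/
def renormVec (w : (ℤ × ℤ) × (ℤ × ℤ)) : (ℤ × ℤ) × (ℤ × ℤ) := (-mulPhi w.2, -mulPhi w.1)

theorem renorm_add_vec (p : ℝ × ℝ) (w : (ℤ × ℤ) × (ℤ × ℤ)) :
    renorm (p + vec w) = renorm p + vec (renormVec w) := by
  ext <;> simp [renorm, vec, renormVec, val_neg, val_mulPhi] <;> ring

theorem renorm_surjective (p : ℝ × ℝ) : ∃ q, renorm q = p := by
  have := phi_pos.ne'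
  refine ⟨((val (0, 1) - p.2) / phi, (val (1, -1) - p.1) / phi), ?_⟩
  ext <;> simp only [renorm] <;> field_simp <;> ring

/-- `ℤ[φ]` is closed under multiplication by `φ`, so a point on an excluded line would have its
image on one as well. -/
theorem generic_of_renorm_add {p : ℝ × ℝ} {w : (ℤ × ℤ) × (ℤ × ℤ)}
    (h : renorm p + vec w ∈ generic) : p ∈ generic := by
  intro k c hc
  have hinv : ∀ k, renormForm (renormForm k) = k := by decide
  refine h (renormForm k) (intForm ((1, -1), (0, 1)) (renormForm k) + mulPhi c
    + intForm w (renormForm k)) ?_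
  rw [form_add, form_renorm, form_vec, hinv, hc, val_add, val_add, val_mulPhi]

/-- The linear part of `renorm` exchanges the coordinates and multiplies them by `-φ`, which scales
the sup metric exactly. -/
theorem dist_renorm_add (p q v : ℝ × ℝ) :
    dist (renorm p + v) (renorm q + v) = phi * dist p q := by
  have hp := phi_pos
  simp only [dist_add_right, Prod.dist_eq, renorm, dist_sub_left, Real.dist_eq]
  rw [← mul_sub, ← mul_sub, abs_mul, abs_mul, abs_of_pos hp, mul_max_of_nonneg _ _ hp.le, max_comm]

/-- The pieces that the `i`-th piece of the renormalized map meets before it returns. -/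
def path : Fin 12 → List (Fin 12) := ![
  [11], [8, 2], [8, 1, 9], [8, 1], [7, 6, 3, 1, 9], [7, 6, 2], [7, 5], [7, 5], [6, 3, 1],
  [6, 2], [6, 1], [4]]

/-- The sum of the translation vectors along a path. -/
def total : List (Fin 12) → (ℤ × ℤ) × (ℤ × ℤ)
  | [] => 0
  | i :: l => move i + total l

theorem total_append (l l' : List (Fin 12)) : total (l ++ l') = total l + total l' := by
  induction l with
  | nil => simp [total]
  | cons i l ih => simp [total, ih, add_assoc]

/-- All points of the hexagon follow the path. -/
def follows : (Fin 6 → ℤ × ℤ) → List (Fin 12) → Bool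
  | _, [] => true
  | h, i :: l => isSub h (piece i) && forceHex (shift h (move i)) fun h' => follows h' l

/-- The split allows an orbit to be stopped in the middle of a path, where the tiles lie; `l' = []`
gives the whole path. -/
theorem follows_append {h : Fin 6 → ℤ × ℤ} {l l' : List (Fin 12)} (H : follows h (l ++ l') = true)
    {p : ℝ × ℝ} (hp : p ∈ hexagon h) : Relation.ReflTransGen Step p (p + vec (total l)) ∧
      ∃ h', p + vec (total l) ∈ hexagon h' ∧ follows h' l' = true := by
  induction l generalizing h p with
  | nil => exact ⟨by simp [total, vec_zero, Relation.ReflTransGen.refl],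
      h, by simpa [total, vec_zero] using hp, H⟩
  | cons i l ih =>
    simp only [List.cons_append, follows, forceHex_eq, Bool.and_eq_true] at H
    obtain ⟨h1, h2⟩ := ih H.2 ((add_mem_shift (move i)).2 hp)
    have e : p + vec (total (i :: l)) = p + vec (move i) + vec (total l) := by
      rw [total, vec_add, add_assoc]
    rw [e]
    exact ⟨.head ⟨i, hexagon_subset H.1 hp, rfl⟩ h1, h2⟩

theorem follows_path : ∀ l, follows (renormHex (piece l)) (path l) = true := by decide +kernel

/-- The conjugacy itself: following the path of `l` from `renorm p` ends at the image under `renorm`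
of the translate of `p`. -/
theorem total_path : ∀ l, total (path l) = renormVec (move l) := by decide +kernel

theorem reflTransGen_renorm {p q : ℝ × ℝ} (h : Relation.ReflTransGen Step p q) :
    Relation.ReflTransGen Step (renorm p) (renorm q) := by
  refine Relation.ReflTransGen.lift' renorm ?_ _ _ h
  rintro p _ ⟨i, hi, rfl⟩
  have := (follows_append (l := path i) (l' := []) (by simpa using follows_path i)
    (renorm_mem.2 hi)).1
  rwa [total_path, ← renorm_add_vec] at this

/-! ### Periodic points under renormalization -/

/-- The point `p` of the `i`-th piece is periodic. -/
def IsPeriodicIn (i : Fin 12) (p : ℝ × ℝ) : Prop :=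
  p ∈ hexagon (piece i) ∧ Relation.ReflTransGen Step (p + vec (move i)) p

theorem IsPeriodicIn.transGen {i : Fin 12} {p : ℝ × ℝ} (h : IsPeriodicIn i p) :
    Relation.TransGen Step p p :=
  .head' ⟨i, h.1, rfl⟩ h.2

/-- The translates of renormalized pieces in the `i`-th piece; `(l, n)` stands for the renormalized
piece `l` after `n` steps. -/
def tiles : Fin 12 → List (Fin 12 × ℕ) := ![
  [], [(2, 1), (3, 1), (4, 3), (8, 2), (10, 1)], [(1, 1), (5, 2), (9, 1)], [(4, 2), (8, 1)],
  [(11, 0)], [(6, 1), (7, 1)], [(4, 1), (5, 1), (8, 0), (9, 0), (10, 0)],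
  [(4, 0), (5, 0), (6, 0), (7, 0)], [(1, 0), (2, 0), (3, 0)], [(2, 2), (4, 4)], [], [(0, 0)]]

theorem path_eq_of_mem_tiles : ∀ i, ∀ t ∈ tiles i,
    path t.1 = (path t.1).take t.2 ++ i :: (path t.1).drop (t.2 + 1) := by decide +kernel

theorem IsPeriodicIn.renorm_add {i : Fin 12} {t : Fin 12 × ℕ} (ht : t ∈ tiles i) {p : ℝ × ℝ}
    (h : IsPeriodicIn t.1 p) :
    IsPeriodicIn i (renorm p + vec (total ((path t.1).take t.2))) := by
  have e := path_eq_of_mem_tiles i t ht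
  set l₁ := (path t.1).take t.2
  set l₂ := (path t.1).drop (t.2 + 1)
  have hf := follows_path t.1
  rw [e] at hf
  obtain ⟨h1, h', hmem, hf'⟩ := follows_append hf (renorm_mem.2 h.1)
  simp only [follows, forceHex_eq, Bool.and_eq_true] at hf'
  have h2 := (follows_append (l := l₂) (l' := []) (by simpa using hf'.2)
    ((add_mem_shift (move i)).2 hmem)).1
  refine ⟨hexagon_subset hf'.1 hmem, (h2.trans ?_).trans h1⟩
  have e2 := total_path t.1
  rw [e, total_append, total] at e2
  -- The loop closes in three arcs: the rest of the path leads to the renormalized image of the next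
  -- point, the renormalized orbit leads back to `renorm p`, and `l₁` leads to the starting point.
  have e3 : renorm p + vec (total l₁) + vec (move i) + vec (total l₂)
      = renorm (p + vec (move t.1)) := by
    rw [renorm_add_vec, ← e2, vec_add, vec_add]
    simp only [add_assoc]
  rw [e3]
  exact reflTransGen_renorm h.2

theorem isPeriodicIn_of_move_eq_zero {i : Fin 12} (hi : move i = 0) {p : ℝ × ℝ}
    (hp : p ∈ hexagon (piece i)) : IsPeriodicIn i p :=
  ⟨hp, by rw [hi, vec_zero, add_zero]⟩

/-- The hexagon of a tile. -/
def tileHex (t : Fin 12 × ℕ) : Fin 6 → ℤ × ℤ :=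
  shift (renormHex (piece t.1)) (total ((path t.1).take t.2))

theorem isCovered_piece : ∀ i,
    move i = 0 ∨ isCovered ((tiles i).map tileHex) (piece i) = true := by
  decide +kernel

theorem isCovered_hexF : isCovered ((List.finRange 12).map piece) (hexF 0) = true := by
  decide +kernel

/-! ### Approximation by periodic points -/

theorem exists_isPeriodicIn (i : Fin 12) : ∃ p, IsPeriodicIn i p := by
  have h1 := phi_gt
  have h2 := phi_lt
  have step : ∀ {i : Fin 12} (t : Fin 12 × ℕ), t ∈ tiles i → (∃ p, IsPeriodicIn t.1 p) →
      ∃ p, IsPeriodicIn i p := fun t ht ⟨p, hp⟩ => ⟨_, hp.renorm_add ht⟩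
  -- Pieces 0 and 10 are fixed pointwise, so any point in them serves; every other piece inherits a
  -- periodic point through a chain of tiles starting from one of these.
  have p0 : ∃ p, IsPeriodicIn 0 p := by
    refine ⟨(0.8, 0.5), isPeriodicIn_of_move_eq_zero (by decide +kernel) fun k => ?_⟩
    fin_cases k <;> simp [form, piece, val] <;> linarith
  have p10 : ∃ p, IsPeriodicIn 10 p := by
    refine ⟨(0.5, 0.2), isPeriodicIn_of_move_eq_zero (by decide +kernel) fun k => ?_⟩
    fin_cases k <;> simp [form, piece, val] <;> linarith
  have p11 := step (i := 11) (0, 0) (by decide +kernel) p0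
  have p4 := step (i := 4) (11, 0) (by decide +kernel) p11
  have p1 := step (i := 1) (10, 1) (by decide +kernel) p10
  have p6 := step (i := 6) (10, 0) (by decide +kernel) p10
  have p2 := step (i := 2) (1, 1) (by decide +kernel) p1
  have p8 := step (i := 8) (1, 0) (by decide +kernel) p1
  have p5 := step (i := 5) (6, 1) (by decide +kernel) p6
  have p7 := step (i := 7) (6, 0) (by decide +kernel) p6
  have p3 := step (i := 3) (8, 1) (by decide +kernel) p8
  have p9 := step (i := 9) (2, 2) (by decide +kernel) p2
  fin_cases i <;> assumption

theorem dist_le_of_mem_piece {i : Fin 12} {p q : ℝ × ℝ} (hp : p ∈ hexagon (piece i))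
    (hq : q ∈ hexagon (piece i)) : dist p q ≤ 1 := by
  have hsub : ∀ i, isSub (piece i) (hexF 0) = true := by decide +kernel
  have key : ∀ p ∈ hexagon (piece i), 0 < p.1 ∧ p.1 < 1 ∧ 0 < p.2 ∧ p.2 < 1 := by
    intro p hp
    have h := hexagon_subset (hsub i) hp
    have h0 := h 0
    have h1 := h 1
    have h2 := h 2
    have h3 := h 3
    have := phi_lt
    simp [form, hexF, val] at h0 h1 h2 h3
    exact ⟨h1, h0, h3, by linarith⟩
  obtain ⟨a1, a2, a3, a4⟩ := key p hp
  obtain ⟨b1, b2, b3, b4⟩ := key q hq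
  rw [Prod.dist_eq, Real.dist_eq, Real.dist_eq]
  exact max_le (abs_le.2 ⟨by linarith, by linarith⟩) (abs_le.2 ⟨by linarith, by linarith⟩)

/-- Each covering step pulls `p` back to a generic point of another piece, and pushing the
approximation forward again gains a factor `φ`. The piece changes at each step, so the induction is
over all pieces at once. -/
theorem exists_isPeriodicIn_dist_le (n : ℕ) {i : Fin 12} {p : ℝ × ℝ}
    (hp : p ∈ hexagon (piece i)) (hg : p ∈ generic) :
    ∃ q, IsPeriodicIn i q ∧ dist p q ≤ phi ^ n := by
  induction n generalizing i p with
  | zero =>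
    obtain ⟨q, hq⟩ := exists_isPeriodicIn i
    exact ⟨q, hq, by simpa using dist_le_of_mem_piece hp hq.1⟩
  | succ n ih =>
    rcases isCovered_piece i with h | h
    · exact ⟨p, isPeriodicIn_of_move_eq_zero h hp, by simpa using pow_nonneg phi_pos.le _⟩
    · obtain ⟨_, ht, hpt⟩ := exists_mem_of_isCovered h hp hg
      obtain ⟨t, hti, rfl⟩ := List.mem_map.1 ht
      set w := total ((path t.1).take t.2) with hw
      obtain ⟨p', hp'⟩ := renorm_surjective (p - vec w)
      obtain rfl : p = renorm p' + vec w := by rw [hp', sub_add_cancel]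
      have hmem : p' ∈ hexagon (piece t.1) := renorm_mem.1 ((add_mem_shift w).1 hpt)
      obtain ⟨q, hq, hd⟩ := ih hmem (generic_of_renorm_add hg)
      refine ⟨_, hq.renorm_add hti, ?_⟩
      rw [← hw, dist_renorm_add, pow_succ']
      exact mul_le_mul_of_nonneg_left hd phi_pos.le

theorem hexF_subset_closure :
    hexagon (hexF 0) ⊆ closure {p | Relation.TransGen Step p p} := by
  have hopen : IsOpen (hexagon (hexF 0)) := by
    have : hexagon (hexF 0) = ⋂ k, {p | form p k < val (hexF 0 k)} := by
      ext; simp [hexagon]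
    rw [this]
    refine isOpen_iInter_of_finite fun k => isOpen_lt ?_ continuous_const
    fin_cases k <;> simp [form] <;> fun_prop
  refine (dense_generic.open_subset_closure_inter hopen).trans (closure_minimal ?_ isClosed_closure)
  rintro p ⟨hp, hg⟩
  obtain ⟨_, ht, hpt⟩ := exists_mem_of_isCovered isCovered_hexF hp hg
  obtain ⟨i, -, rfl⟩ := List.mem_map.1 ht
  rw [Metric.mem_closure_iff]
  intro ε hε
  obtain ⟨n, hn⟩ := exists_pow_lt_of_lt_one hε (by linarith [phi_lt] : phi < 1)
  obtain ⟨q, hq, hd⟩ := exists_isPeriodicIn_dist_le n hpt hg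
  exact ⟨q, hq.transGen, hd.trans_lt hn⟩

/-! ### The pieces in the plane -/

theorem phi_lt_one : phi < 1 := by linarith [phi_lt]

theorem floor_inv_phi : ⌊1 / phi⌋ = 1 := by
  have h := phi_gt
  have h0 := phi_pos
  rw [Int.floor_eq_iff, le_div_iff₀ h0, div_lt_iff₀ h0]
  exact ⟨by simpa using phi_lt_one.le, by push_cast; linarith⟩

/-- The linear map from oblique coordinates to the plane. -/
noncomputable def plane : ℝ × ℝ →L[ℝ] ℝ × ℝ :=
  ((2 : ℝ) • ContinuousLinearMap.fst ℝ ℝ ℝ + ContinuousLinearMap.snd ℝ ℝ ℝ).prod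
    (√3 • ContinuousLinearMap.snd ℝ ℝ ℝ)

theorem plane_apply (p : ℝ × ℝ) : plane p = (2 * p.1 + p.2, √3 * p.2) := by
  simp [plane]

/-- The point of the plane with the given oblique coordinates. -/
noncomputable def place (p : ℝ × ℝ) : ℝ × ℝ := plane p - center phi

theorem place_add (p q : ℝ × ℝ) : place (p + q) = place p + plane q := by
  simp [place]; abel

theorem plane_intShort (k : Fin 3) : plane (vec (intShort k)) = short phi k := by
  fin_cases k <;> ext <;> simp [plane_apply, vec, val, intShort, short]; ring

theorem plane_intLong (k : Fin 3) : plane (vec (intLong k)) = long k := by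
  fin_cases k <;> ext <;> simp [plane_apply, vec, val, intLong, long]; norm_num

theorem plane_intCutShift (c : Bool) : plane (vec (intCutShift c)) = cutShift phi c := by
  cases c <;> ext <;> simp [plane_apply, vec, val, intCutShift, cutShift, -one_div,
    floor_inv_phi]; ring

theorem plane_mem_F {k : Fin 3} {p : ℝ × ℝ} (hp : p ∈ hexagon (hexF k)) :
    plane p ∈ F phi k := by
  have h0 := phi_pos
  have a0 := hp 0
  have a1 := hp 1
  have a2 := hp 2
  have a3 := hp 3
  have a4 := hp 4
  have a5 := hp 5
  fin_cases k <;> simp [form, hexF, val] at a0 a1 a2 a3 a4 a5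
  · refine ⟨p.1, ⟨a1, a0⟩, p.2 / phi, ⟨by positivity, by rwa [div_lt_one h0]⟩, ?_⟩
    ext <;> simp [plane_apply, long, short] <;> field_simp
  · refine ⟨p.2, ⟨a3, a2⟩, -(p.1 + p.2) / phi, ⟨by apply div_pos <;> linarith, ?_⟩, ?_⟩
    · rw [div_lt_one h0]; linarith
    · ext <;> simp [plane_apply, long, short] <;> field_simp; ring
  · refine ⟨-(p.1 + p.2), ⟨by linarith, by linarith⟩, p.1 / phi,
      ⟨by positivity, by rwa [div_lt_one h0]⟩, ?_⟩
    ext <;> simp [plane_apply, long, short] <;> field_simp <;> ring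

theorem place_mem_cutPart {c : Bool} {p : ℝ × ℝ} (hp : p ∈ hexagon (hexCut c)) :
    place p ∈ cutPart phi c := by
  have h0 := phi_pos
  have h1 := phi_lt_one
  have a0 := hp 0
  have a1 := hp 1
  have a2 := hp 2
  have a3 := hp 3
  cases c <;> simp [form, hexCut, val] at a0 a1 a2 a3
  · refine ⟨(p.1 - (1 - phi)) / phi, ⟨by apply div_pos <;> linarith, ?_⟩,
      p.2 / phi, ⟨by positivity, by rwa [div_lt_one h0]⟩, ?_⟩
    · rw [div_lt_one h0]; linarith
    · ext <;> simp [place, plane_apply, short, -one_div, floor_inv_phi] <;> field_simp <;> ring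
  · have h2 : 0 < 1 - phi := by linarith
    refine ⟨p.1 / (1 - phi), ⟨by positivity, by rw [div_lt_one h2]; linarith⟩,
      p.2 / phi, ⟨by positivity, by rwa [div_lt_one h0]⟩, ?_⟩
    ext <;> simp [place, plane_apply, short, -one_div, floor_inv_phi] <;> field_simp <;> ring

/-- The label of the `i`-th piece. -/
noncomputable def label (i : Fin 12) : Label phi where
  pre := (cuts i).1
  vec k := ⟨plane (vec (intStep i k)), by
    rw [L, AddSubgroup.mem_closure_pair]
    refine ⟨(steps i k).1, (steps i k).2, ?_⟩
    rw [intStep, vec_add, vec_zsmul, vec_zsmul, map_add, map_zsmul, map_zsmul, plane_intShort,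
      plane_intLong]⟩
  post := (cuts i).2

theorem V_label (i : Fin 12) : V phi (label i) = plane (vec (move i)) := by
  simp only [V, label, move, vec_add, vec_neg, map_add, map_neg, plane_intCutShift]

/-- The whole hexagon is followed through the inverse cut-and-paste and the three lattice steps;
each translate must lie in the prescribed parallelogram or part, which is a comparison of bounds. -/
theorem place_mem_A {i : Fin 12} {p : ℝ × ℝ} (hp : p ∈ hexagon (piece i)) :
    place p ∈ A phi (label i) := by
  have key : ∀ {i : Fin 12} {p : ℝ × ℝ}, p ∈ hexagon (piece i) →
      ∀ w (h : Fin 6 → ℤ × ℤ), isSub (shift (piece i) w) h = true → p + vec w ∈ hexagon h :=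
    fun hp w h H => hexagon_subset H ((add_mem_shift w).2 hp)
  have hcheck : ∀ i,
      isSub (shift (piece i) (-intCutShift (cuts i).1)) (hexCut (cuts i).1) = true ∧
      isSub (shift (piece i) (-intCutShift (cuts i).1)) (hexF 0) = true ∧
      isSub (shift (piece i) (-intCutShift (cuts i).1 + intStep i 0)) (hexF 1) = true ∧
      isSub (shift (piece i) (-intCutShift (cuts i).1 + intStep i 0 + intStep i 1))
        (hexF 2) = true ∧
      isSub (shift (piece i) (-intCutShift (cuts i).1 + intStep i 0 + intStep i 1 + intStep i 2))
        (hexF 0) = true ∧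
      isSub (shift (piece i) (-intCutShift (cuts i).1 + intStep i 0 + intStep i 1 + intStep i 2))
        (hexCut (cuts i).2) = true := by
    decide +kernel
  obtain ⟨c1, c2, c3, c4, c5, c6⟩ := hcheck i
  have e : ∀ p, place p + center phi = plane p := fun p => by simp [place]
  refine ⟨place (p + vec (-intCutShift (cuts i).1)), place_mem_cutPart (key hp _ _ c1), ?_, ?_, ?_,
    ?_, ?_, ?_⟩
  · simp [place_add, vec_neg, plane_intCutShift, label]
  · rw [e]
    exact plane_mem_F (key hp _ _ c2)
  · have := plane_mem_F (key hp _ _ c3)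
    simp only [vec_add, ← add_assoc, map_add] at this
    simpa only [e, map_add, label] using this
  · have := plane_mem_F (key hp _ _ c4)
    simp only [vec_add, ← add_assoc, map_add] at this
    simpa only [e, map_add, label] using this
  · have := plane_mem_F (key hp _ _ c5)
    simp only [vec_add, ← add_assoc, map_add] at this
    simpa only [e, map_add, label] using this
  · have := place_mem_cutPart (key hp _ _ c6)
    simp only [vec_add, ← add_assoc, place_add] at this
    simpa only [place_add, label] using this

/-! ### Orbits of the partial map -/

theorem petMap_eq_some {l : Label phi} {p : ℝ × ℝ} (hp : p ∈ A phi l) :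
    petMap (A phi) (V phi) p = Part.some (p + V phi l) := by
  have h : ∃ l, p ∈ A phi l := ⟨l, hp⟩
  -- Here determinism enters: `Step` is only a relation, and disjointness of the pieces makes the
  -- chosen label the expected one.
  have e : h.choose = l := A_disjoint phi_pos phi_lt_one h.choose_spec hp
  refine Part.eq_some_iff.2 ⟨h, ?_⟩
  change p + V phi h.choose = _
  rw [e]

theorem petIter_succ_mem {E : Type*} {f : E →. E} {n : ℕ} {x y z : E} (hy : y ∈ petIter f n x)
    (hz : z ∈ f y) : z ∈ petIter f (n + 1) x := by
  rw [petIter, Function.iterate_succ_apply']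
  exact Part.mem_bind hy hz

theorem Step.mem_petMap {p q : ℝ × ℝ} (h : Step p q) :
    place q ∈ petMap (A phi) (V phi) (place p) := by
  obtain ⟨i, hi, rfl⟩ := h
  rw [petMap_eq_some (place_mem_A hi), V_label, place_add]
  exact Part.mem_some _

theorem isPeriodicPoint_of_transGen {p : ℝ × ℝ} (h : Relation.TransGen Step p p) :
    IsPeriodicPoint (petMap (A phi) (V phi)) (place p) := by
  suffices ∀ {q}, Relation.TransGen Step p q →
      ∃ n, 0 < n ∧ place q ∈ petIter (petMap (A phi) (V phi)) n (place p) from this h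
  intro q hq
  induction hq with
  | single h => exact ⟨1, one_pos, petIter_succ_mem (n := 0) (Part.mem_some _) h.mem_petMap⟩
  | tail _ h ih =>
    obtain ⟨n, -, hn⟩ := ih
    exact ⟨n + 1, n.succ_pos, petIter_succ_mem hn h.mem_petMap⟩

/-- A loop can be rotated to start at its next point, so the orbit never leaves the hexagons and
every iterate is defined. -/
theorem exists_hasCoding {p : ℝ × ℝ} (h : Relation.TransGen Step p p) :
    ∃ ω, HasCoding (A phi) (V phi) (place p) ω := by
  have key : ∀ n, ∃ q, Relation.TransGen Step q q ∧
      place q ∈ petIter (petMap (A phi) (V phi)) n (place p) := by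
    intro n
    induction n with
    | zero => exact ⟨p, h, Part.mem_some _⟩
    | succ n ih =>
      obtain ⟨q, hq, hn⟩ := ih
      obtain ⟨r, hqr, hrq⟩ := Relation.TransGen.head'_iff.1 hq
      exact ⟨r, .tail' hrq hqr, petIter_succ_mem hn hqr.mem_petMap⟩
  have : ∀ n, ∃ l, ∃ y ∈ petIter (petMap (A phi) (V phi)) n (place p), y ∈ A phi l := by
    intro n
    obtain ⟨q, hq, hn⟩ := key n
    obtain ⟨_, ⟨i, hi, -⟩, -⟩ := Relation.TransGen.head'_iff.1 hq
    exact ⟨label i, _, hn, place_mem_A hi⟩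
  choose ω hω using this
  exact ⟨ω, hω⟩

theorem place_mem_Delta {p : ℝ × ℝ} (h : Relation.TransGen Step p p) : place p ∈ Delta phi := by
  obtain ⟨ω, hω⟩ := exists_hasCoding h
  exact mem_biUnion (isPeriodicPoint_of_transGen h) ⟨ω, hω, hω⟩

/-! ### The periodic pattern is dense -/

theorem continuous_place : Continuous place := plane.continuous.sub continuous_const

theorem X_eq_image : X phi = place '' (Icc 0 1 ×ˢ Icc 0 phi) := by
  have h0 := phi_pos
  ext p
  constructor
  · rintro ⟨a, ha, b, hb, rfl⟩
    refine ⟨(a, b * phi), ⟨ha, ⟨mul_nonneg hb.1 h0.le, mul_le_of_le_one_left h0.le hb.2⟩⟩, ?_⟩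
    ext <;> simp [place, plane_apply, long, short] <;> ring
  · rintro ⟨⟨a, b⟩, ⟨ha, hb⟩, rfl⟩
    refine ⟨a, ha, b / phi, ⟨div_nonneg hb.1 h0.le, div_le_one_of_le₀ hb.2 h0.le⟩, ?_⟩
    ext <;> simp [place, plane_apply, long, short] <;> field_simp <;> ring

theorem isClosed_X : IsClosed (X phi) := by
  rw [X_eq_image]
  exact ((isCompact_Icc.prod isCompact_Icc).image continuous_place).isClosed

theorem A_subset_X (l : Label phi) : A phi l ⊆ X phi := by
  have h0 := phi_pos
  have h1 := phi_lt_one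
  rintro _ ⟨q, hq, rfl, -⟩
  cases hl : l.pre <;> rw [hl] at hq <;> obtain ⟨a, ha, b, hb, rfl⟩ := hq
  · refine ⟨a * phi, ⟨mul_nonneg ha.1.le h0.le, by nlinarith [ha.2]⟩, b, Ioo_subset_Icc_self hb, ?_⟩
    ext <;> simp [cutShift, long, short, -one_div, floor_inv_phi]; ring
  · have h2 : 0 ≤ a * (1 - phi) := mul_nonneg ha.1.le (by linarith)
    refine ⟨a * (1 - phi) + phi, ⟨by linarith, by nlinarith [ha.2]⟩, b, Ioo_subset_Icc_self hb, ?_⟩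
    ext <;> simp [cutShift, long, short, -one_div, floor_inv_phi]; ring

theorem Delta_subset_X : Delta phi ⊆ X phi := by
  intro q hq
  obtain ⟨p, -, ω, -, hω⟩ := mem_iUnion₂.1 hq
  obtain ⟨y, hy, hA⟩ := hω 0
  rw [Part.mem_some_iff.1 hy] at hA
  exact A_subset_X _ hA

theorem X_subset_closure_Delta : X phi ⊆ closure (Delta phi) := by
  have hsub : Icc (0 : ℝ) 1 ×ˢ Icc 0 phi ⊆ closure {p | Relation.TransGen Step p p} := by
    -- The boundary of `X phi` is recovered by taking closures; only the open rectangle must be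
    -- approximated.
    rw [← closure_Ioo zero_ne_one, ← closure_Ioo phi_pos.ne, ← closure_prod_eq]
    refine closure_minimal (Subset.trans ?_ hexF_subset_closure) isClosed_closure
    rintro p ⟨⟨h1, h2⟩, h3, h4⟩ k
    fin_cases k <;> simp [form, hexF, val] <;> linarith
  rw [X_eq_image]
  refine (image_mono hsub).trans ((image_closure_subset_closure_image continuous_place).trans
    (closure_mono ?_))
  rintro _ ⟨p, hp, rfl⟩
  exact place_mem_Delta hp

end TripleLattice

theorem mainTheorem5 :
    closure (TripleLattice.Delta ((√5 - 1) / 2)) = TripleLattice.X ((√5 - 1) / 2) :=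
  (closure_minimal TripleLattice.Delta_subset_X TripleLattice.isClosed_X).antisymm
    TripleLattice.X_subset_closure_Delta
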